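/- Let $\mathbb{D}=\{\alpha\in\mathbb{C}:|\alpha|<1\}$, $S^1=\mathbb{R}/2\pi\mathbb{Z}$, $\mathbb{T}^N=(S^1)^N$ and $\mathbb{D}_{\delta_0}=\{z\in\mathbb{C}:|z|<1-\delta_0\}$. For $\alpha\in\mathbb{D}$, $\psi\in S^1$, $\theta\in\mathbb{T}^N$ define the order parameter $$z(\alpha,\psi,\theta)=\frac1N\sum_{j=1}^N\frac{\alpha+e^{i\psi}e^{i\theta_j}}{1+\bar\alpha\, e^{i\psi}e^{i\theta_j}} .$$ Let $\Theta\subset\mathbb{T}^N$ be the set of splay states: those $\theta$ for which there is $\varphi\in S^1$ with $\theta_j=\frac{2\pi j}{N}+\varphi$ up to a permutation of the indices. For parameters $\sigma,\delta,\beta$ consider the Watanabe--Strogatz equations of a star network with $N$ leaves on $\mathbb{D}\times S^1$, with constants of motion $\theta\in\mathbb{T}^N$, $$\dot\alpha=i\,(f\alpha^2+g\alpha+\bar f),\qquad \dot\psi=f\alpha+g+\bar f\bar\alpha,$$ $$f=-\frac{\sigma e^{-i\delta}}{2i},\qquad g=1-\beta-\sigma\beta\,\frac{z e^{i\delta}-\bar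 z e^{-i\delta}}{2i},\qquad z=z(\alpha,\psi,\theta).$$ Let $\alpha^I\in\mathbb{C}$ be given by $$\alpha^I=\frac{\beta-1-\sqrt{(\beta-1)^2-\sigma^2(1+2\beta\cos 2\delta)}}{\sigma(1+2\beta\cos 2\delta)}\;e^{i(\delta-\pi/2)} .$$ **Theorem.** Let $k\in\mathbb{N}$, $\delta_0>0$, $0<\delta<\pi/4$, $0<\sigma<1$ and $\varepsilon>0$. There are $N_0\in\mathbb{N}$ and $\beta_0>0$ such that for every $N>N_0$ there is an open neighbourhood $U\subset\mathbb{T}^N$ of $\Theta$ with the following two properties. 1. For all $\theta\in U$ and $\psi\in S^1$, the map $\alpha\mapsto z(\alpha,\psi,\theta)-\alpha$ is $C^k$ on $\mathbb{D}_{\delta_0}$ (in the real sense), and all its derivatives of order $0,\dots,k$ have norm at most $\varepsilon$ there. 2. For every $\beta>\beta_0$ and every $z_0\in\mathbb{D}_{\delta_0}$ there is $T_0>0$ such that, for every $\theta\in U$ and every solution $(\alpha(t),\psi(t))$, $t\ge0$, of the equations above with $z(\alpha(0),\psi(0),\theta)=z_0$, the order parameter in the time $\tau=\beta t$, $z(\tau):=z(\alpha(\tau/\beta),\psi(\tau/\beta),\theta)$,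 satisfies $$|z(\tau)-\alpha^I|\le\varepsilon\qquad\text{for all }\tau>T_0 .$$ -/

import Mathlib

open Complex Set

open scoped ComplexConjugate

noncomputable section

namespace StarNetwork

/-- The Möbius map `M_{α,ψ}(w) = (α + e^{iψ} w) / (1 + conj α · e^{iψ} w)`. -/
def mobius (α : ℂ) (ψ : ℝ) (w : ℂ) : ℂ :=
  (α + exp (ψ * I) * w) / (1 + conj α * exp (ψ * I) * w)

/-- The order parameter `z(α,ψ,θ) = (1/N) ∑_j M_{α,ψ}(e^{iθ_j})`, for `θ` in the torus `𝕋^N`. -/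
def orderParam {N : ℕ} (α : ℂ) (ψ : ℝ) (θ : Fin N → Real.Angle) : ℂ :=
  (1 / (N : ℂ)) * ∑ j, mobius α ψ ((θ j).toCircle : ℂ)

/-- The uniformly distributed (splay) states: `θ_j = 2πj/N + φ` up to a permutation. -/
def splayStates (N : ℕ) : Set (Fin N → Real.Angle) :=
  {θ | ∃ (φ : Real.Angle) (s : Equiv.Perm (Fin N)),
    ∀ j, θ j = ((2 * Real.pi * ((s j : ℕ) : ℝ) / (N : ℝ) : ℝ) : Real.Angle) + φ}

/-- The coefficient `f = -σ e^{-iδ} / (2i)`. -/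
def wsF (σ δ : ℝ) : ℂ := -(σ : ℂ) * exp (-(δ * I)) / (2 * I)

/-- The coefficient `g = 1 - β - σβ (z e^{iδ} - conj z · e^{-iδ}) / (2i)`; the last quotient
is the imaginary part of `z e^{iδ}`. -/
def wsG (σ δ β : ℝ) (z : ℂ) : ℝ := 1 - β - σ * β * (z * exp (δ * I)).im

/-- `(α, ψ)` is a forward solution, with constants of motion `θ`, of the Watanabe–Strogatz equations
`α' = i (f α² + g α + conj f)` and `ψ' = f α + g + conj f · conj α`, where `g` is evaluated at the
true order parameter `z(α,ψ,θ)`. The parameter `α` moves in the open unit disc, and `ψ` is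
represented by a real lift of the angle. -/
def IsSolution (σ δ β : ℝ) {N : ℕ} (θ : Fin N → Real.Angle) (α : ℝ → ℂ) (ψ : ℝ → ℝ) : Prop :=
  ∀ t : ℝ, 0 ≤ t →
    ‖α t‖ < 1 ∧
    HasDerivWithinAt α
      (I * (wsF σ δ * α t ^ 2 + (wsG σ δ β (orderParam (α t) (ψ t) θ) : ℂ) * α t
        + conj (wsF σ δ))) (Ici 0) t ∧
    HasDerivWithinAt ψ
      (wsF σ δ * α t + (wsG σ δ β (orderParam (α t) (ψ t) θ) : ℂ)
        + conj (wsF σ δ) * conj (α t)).re (Ici 0) t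

/-- The modulus of the incoherent fixed point. -/
def incoherentRadius (σ δ β : ℝ) : ℝ :=
  (β - 1 - Real.sqrt ((β - 1) ^ 2 - σ ^ 2 * (1 + 2 * β * Real.cos (2 * δ)))) /
    (σ * (1 + 2 * β * Real.cos (2 * δ)))

/-- The incoherent fixed point `α^I`, with argument `-π/2 + δ`. -/
def alphaI (σ δ β : ℝ) : ℂ :=
  (incoherentRadius σ δ β : ℂ) * exp (((-(Real.pi / 2) + δ : ℝ) : ℂ) * I)

/-- `F : ℂ → ℂ` has `C^k`-norm at most `ε` on the disc `|α| < r`, with `ℂ` regarded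
as a real vector space. -/
def CkNormLE (k : ℕ) (r ε : ℝ) (F : ℂ → ℂ) : Prop :=
  ContDiffOn ℝ k F (Metric.ball 0 r) ∧
    ∀ i ≤ k, ∀ α ∈ Metric.ball (0 : ℂ) r, ‖iteratedFDeriv ℝ i F α‖ ≤ ε

end StarNetwork

end

noncomputable section

namespace StarNetwork

/-! The proof has a static and a dynamic half.

Static: z - α equals 1 - |α|² times a kernel mean that is holomorphic in conj α. For equidistributed
phases the mean has a closed form, exponentially small in N on smaller discs; Cauchy estimates turn
this into C^k smallness (`exists_ckNormLE_const`). The dynamics also needs |z - α| ≤ 3/N on the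
whole unit disc, since α is not confined to a smaller disc a priori. Near the boundary this comes
from separation: at most one phase is close to the pole of the kernel
(`exists_radius_kernelMean_le`).

Dynamic: put Y = σ e^{iδ} α = X + iZ. The energy -log(1 - |α|²) has derivative cos(2δ) X + sin(2δ)
Z, independent of g, while for large β the phase of Y turns at speed about -β(1 + Z). Turning more
slowly where Z < 0, Y spends more time there, so on average the energy decreases at a rate of order
sin(2δ)|Y|². A corrector of size O(1/β) makes this pointwise (`lyapunov_drift_le`), up to errors
O(1/β + |z - α|). Hence |α| eventually falls below a prescribed r (`exists_time_norm_le`). As α^I =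
O(1/β), the three quantities |z - α|, |α| and |α^I| are each at most ε/4. -/

/-! ### The order parameter as a perturbation of α -/

/-- The mean of `v_j / (1 + w v_j)`; the order parameter deviates from `α` by
`1 - |α|²` times this mean at `w = conj α`. -/
def kernelMean {N : ℕ} (v : Fin N → ℂ) (w : ℂ) : ℂ :=
  (1 / (N : ℂ)) * ∑ j, v j / (1 + w * v j)

theorem one_sub_norm_le_norm_one_add_mul {w v : ℂ} (hv : ‖v‖ = 1) : 1 - ‖w‖ ≤ ‖1 + w * v‖ := by
  have h := norm_sub_norm_le (1 : ℂ) (-(w * v))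
  rw [norm_neg, norm_mul, hv, norm_one, mul_one, sub_neg_eq_add] at h
  exact h

theorem one_add_mul_ne_zero {w v : ℂ} (hv : ‖v‖ = 1) (hw : ‖w‖ < 1) : 1 + w * v ≠ 0 := by
  have h := one_sub_norm_le_norm_one_add_mul (w := w) hv
  intro h0
  rw [h0, norm_zero] at h
  linarith

/-- The unimodular numbers `e^{iψ} e^{iθ_j}`. -/
def phasors {N : ℕ} (ψ : ℝ) (θ : Fin N → Real.Angle) (j : Fin N) : ℂ :=
  exp (ψ * I) * ((θ j).toCircle : ℂ)

theorem norm_phasors {N : ℕ} (ψ : ℝ) (θ : Fin N → Real.Angle) (j : Fin N) :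
    ‖phasors ψ θ j‖ = 1 := by
  rw [phasors, norm_mul, norm_exp_ofReal_mul_I, Circle.norm_coe, mul_one]

theorem orderParam_sub_self {N : ℕ} (hN : N ≠ 0) {α : ℂ} (hα : ‖α‖ < 1) (ψ : ℝ)
    (θ : Fin N → Real.Angle) :
    orderParam α ψ θ - α = (1 - α * conj α) * kernelMean (phasors ψ θ) (conj α) := by
  have hN' : (N : ℂ) ≠ 0 := Nat.cast_ne_zero.mpr hN
  have hterm : ∀ j, mobius α ψ ((θ j).toCircle : ℂ) =
      α + (1 - α * conj α) * (phasors ψ θ j / (1 + conj α * phasors ψ θ j)) := by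
    intro j
    have h1 : 1 + conj α * phasors ψ θ j ≠ 0 :=
      one_add_mul_ne_zero (norm_phasors ψ θ j) (by rwa [norm_conj])
    have h2 : mobius α ψ ((θ j).toCircle : ℂ) =
        (α + phasors ψ θ j) / (1 + conj α * phasors ψ θ j) := by
      simp only [mobius, phasors, mul_assoc]
    rw [h2, div_eq_iff h1, add_mul, mul_assoc, div_mul_cancel₀ _ h1]
    ring
  unfold orderParam kernelMean
  simp only [hterm, Finset.sum_add_distrib, ← Finset.mul_sum, Finset.sum_const, Finset.card_univ,
    Fintype.card_fin, nsmul_eq_mul]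
  field_simp
  ring

theorem norm_one_sub_mul_conj {α : ℂ} (hα : ‖α‖ < 1) : ‖1 - α * conj α‖ = 1 - ‖α‖ ^ 2 := by
  rw [mul_conj, normSq_eq_norm_sq, ← ofReal_one, ← ofReal_sub, norm_real, Real.norm_eq_abs,
    abs_of_nonneg]
  nlinarith [norm_nonneg α]

theorem norm_orderParam_sub_self {N : ℕ} (hN : N ≠ 0) {α : ℂ} (hα : ‖α‖ < 1) (ψ : ℝ)
    (θ : Fin N → Real.Angle) :
    ‖orderParam α ψ θ - α‖ = (1 - ‖conj α‖ ^ 2) * ‖kernelMean (phasors ψ θ) (conj α)‖ := by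
  rw [orderParam_sub_self hN hα, norm_mul, norm_one_sub_mul_conj hα, norm_conj]

/-! ### Equidistributed phases -/

theorem sum_pow_root_of_unity {N : ℕ} {ζ : ℂ} (hζ : IsPrimitiveRoot ζ N) {m : ℕ}
    (hm : m + 1 < N) : ∑ j : Fin N, (ζ ^ (j : ℕ)) ^ (m + 1) = 0 := by
  have h1 : ζ ^ (m + 1) ≠ 1 := fun h =>
    absurd (Nat.le_of_dvd (Nat.succ_pos m) (hζ.dvd_of_pow_eq_one _ h)) (by omega)
  have h2 : (ζ ^ (m + 1)) ^ N = 1 := by rw [← pow_mul, mul_comm, pow_mul, hζ.pow_eq_one, one_pow]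
  have h3 := geom_sum_eq h1 N
  rw [h2, sub_self, zero_div, ← Fin.sum_univ_eq_sum_range] at h3
  rw [← h3]
  exact Finset.sum_congr rfl fun j _ => by rw [← pow_mul, ← pow_mul, mul_comm]

/-- The kernel mean of `N` equidistributed points in closed form. -/
theorem kernelMean_equidistributed {N : ℕ} (hN : N ≠ 0) {ζ : ℂ} (hζ : IsPrimitiveRoot ζ N)
    {c : ℂ} (hc : ‖c‖ = 1) (s : Equiv.Perm (Fin N)) {w : ℂ} (hw : ‖w‖ < 1) :
    kernelMean (fun j => c * ζ ^ (s j : ℕ)) w =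
      (-w) ^ (N - 1) * c ^ N / (1 - (-w) ^ N * c ^ N) := by
  have hN' : (N : ℂ) ≠ 0 := Nat.cast_ne_zero.mpr hN
  have hD : 1 - (-w) ^ N * c ^ N ≠ 0 := by
    intro h
    have h1 : ‖(-w) ^ N * c ^ N‖ = 1 := by
      rw [← sub_eq_zero.mp h, norm_one]
    rw [norm_mul, norm_pow, norm_pow, hc, one_pow, mul_one, norm_neg] at h1
    exact absurd (pow_lt_one₀ (norm_nonneg w) hw hN) (by rw [h1]; exact lt_irrefl _)
  -- A finite geometric sum; its denominator does not depend on j because every point has the same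
  -- N-th power c^N.
  have hterm : ∀ j : Fin N, (c * ζ ^ (j : ℕ)) / (1 + w * (c * ζ ^ (j : ℕ))) =
      (1 / (1 - (-w) ^ N * c ^ N)) *
        ∑ m ∈ Finset.range N, (-w) ^ m * c ^ (m + 1) * (ζ ^ (j : ℕ)) ^ (m + 1) := by
    intro j
    have hu : ‖c * ζ ^ (j : ℕ)‖ = 1 := by
      rw [norm_mul, norm_pow, hc, hζ.norm'_eq_one hN, one_pow, mul_one]
    have h1 := one_add_mul_ne_zero hu hw
    have h2 := geom_sum_mul_neg (-w * (c * ζ ^ (j : ℕ))) N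
    have h3 : (-w * (c * ζ ^ (j : ℕ))) ^ N = (-w) ^ N * c ^ N := by
      rw [mul_pow, mul_pow, ← pow_mul ζ, mul_comm (j : ℕ), pow_mul, hζ.pow_eq_one, one_pow, mul_one]
    rw [h3] at h2
    have h4 : ∑ m ∈ Finset.range N, (-w) ^ m * c ^ (m + 1) * (ζ ^ (j : ℕ)) ^ (m + 1) =
        (c * ζ ^ (j : ℕ)) * ∑ m ∈ Finset.range N, (-w * (c * ζ ^ (j : ℕ))) ^ m := by
      rw [Finset.mul_sum]
      exact Finset.sum_congr rfl fun m _ => by ring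
    rw [h4, div_eq_iff h1]
    rw [one_div, eq_comm, mul_assoc, inv_mul_eq_iff_eq_mul₀ hD, ← h2]
    ring
  have hperm : ∑ j, (c * ζ ^ (s j : ℕ)) / (1 + w * (c * ζ ^ (s j : ℕ))) =
      ∑ j : Fin N, (c * ζ ^ (j : ℕ)) / (1 + w * (c * ζ ^ (j : ℕ))) :=
    Equiv.sum_comp s fun j : Fin N => (c * ζ ^ (j : ℕ)) / (1 + w * (c * ζ ^ (j : ℕ)))
  obtain ⟨M, rfl⟩ := Nat.exists_eq_succ_of_ne_zero hN
  unfold kernelMean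
  rw [hperm, Finset.sum_congr rfl fun j _ => hterm j, ← Finset.mul_sum, Finset.sum_comm]
  simp only [← Finset.mul_sum]
  -- Averaging over the roots of unity kills every power except the N-th, which is the last summand.
  rw [Finset.sum_range_succ, Finset.sum_eq_zero, zero_add]
  · have : ∀ j : Fin (M + 1), (ζ ^ (j : ℕ)) ^ (M + 1) = 1 := fun j => by
      rw [← pow_mul, mul_comm, pow_mul, hζ.pow_eq_one, one_pow]
    simp only [this, Finset.sum_const, Finset.card_univ, Fintype.card_fin, nsmul_eq_mul]
    field_simp
    rfl
  · intro m hm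
    rw [sum_pow_root_of_unity hζ (by simpa using Finset.mem_range.mp hm), mul_zero]

theorem norm_kernelMean_equidistributed_le {N : ℕ} (hN : N ≠ 0) {ζ : ℂ}
    (hζ : IsPrimitiveRoot ζ N) {c : ℂ} (hc : ‖c‖ = 1) (s : Equiv.Perm (Fin N)) {w : ℂ}
    (hw : ‖w‖ < 1) :
    ‖kernelMean (fun j => c * ζ ^ (s j : ℕ)) w‖ ≤ ‖w‖ ^ (N - 1) / (1 - ‖w‖ ^ N) := by
  rw [kernelMean_equidistributed hN hζ hc s hw, norm_div, norm_mul, norm_pow, norm_pow, hc,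
    one_pow, mul_one, norm_neg]
  have h1 : 0 < 1 - ‖w‖ ^ N := sub_pos.mpr (pow_lt_one₀ (norm_nonneg w) hw hN)
  have h2 := norm_sub_norm_le (1 : ℂ) ((-w) ^ N * c ^ N)
  rw [norm_mul, norm_pow, norm_pow, hc, one_pow, mul_one, norm_neg, norm_one] at h2
  exact div_le_div_of_nonneg_left (by positivity) h1 h2

/-- The factor 1 - r cancels against 1 - r^N, leaving a geometric sum of N terms, each at least
r^(N-1). The bound is uniform up to the boundary of the disc. -/
theorem one_sub_sq_mul_pow_div_le {N : ℕ} (hN : N ≠ 0) {r : ℝ} (hr : 0 ≤ r) (hr1 : r < 1) :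
    (1 - r ^ 2) * (r ^ (N - 1) / (1 - r ^ N)) ≤ 2 / N := by
  have hNpos : (0 : ℝ) < N := by exact_mod_cast Nat.pos_of_ne_zero hN
  have h1 : 0 < 1 - r ^ N := sub_pos.mpr (pow_lt_one₀ hr hr1 hN)
  have h2 : (N : ℝ) * r ^ (N - 1) ≤ ∑ m ∈ Finset.range N, r ^ m := by
    have := Finset.card_nsmul_le_sum (Finset.range N) (fun m => r ^ m) (r ^ (N - 1)) fun m hm =>
      pow_le_pow_of_le_one hr hr1.le (by have := Finset.mem_range.mp hm; omega)
    simpa using this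
  have h3 := geom_sum_mul_neg r N
  rw [← mul_div_assoc, div_le_div_iff₀ h1 hNpos, ← h3]
  have h4 : 0 ≤ ∑ m ∈ Finset.range N, r ^ m := Finset.sum_nonneg fun m _ => pow_nonneg hr m
  have h5 : (1 - r) * (1 + r) * (N * r ^ (N - 1)) ≤
      (1 - r) * (1 + r) * ∑ m ∈ Finset.range N, r ^ m :=
    mul_le_mul_of_nonneg_left h2 (by nlinarith)
  nlinarith [mul_nonneg h4 (sub_nonneg.mpr hr1.le),
    mul_nonneg (mul_nonneg h4 (sub_nonneg.mpr hr1.le)) (sub_nonneg.mpr hr1.le)]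

/-! ### Phases close to equidistribution -/

theorem norm_kernelMean_sub_le {N : ℕ} (hN : N ≠ 0) {v v' : Fin N → ℂ} (hv : ∀ j, ‖v j‖ = 1)
    (hv' : ∀ j, ‖v' j‖ = 1) {η : ℝ} (h : ∀ j, ‖v j - v' j‖ ≤ η) {w : ℂ} {r : ℝ} (hr : r < 1)
    (hw : ‖w‖ ≤ r) :
    ‖kernelMean v w - kernelMean v' w‖ ≤ η / (1 - r) ^ 2 := by
  have hNpos : (0 : ℝ) < N := by exact_mod_cast Nat.pos_of_ne_zero hN
  have hterm : ∀ j, ‖v j / (1 + w * v j) - v' j / (1 + w * v' j)‖ ≤ η / (1 - r) ^ 2 := by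
    intro j
    have h1 := one_add_mul_ne_zero (hv j) (hw.trans_lt hr)
    have h2 := one_add_mul_ne_zero (hv' j) (hw.trans_lt hr)
    have h3 : v j / (1 + w * v j) - v' j / (1 + w * v' j) =
        (v j - v' j) / ((1 + w * v j) * (1 + w * v' j)) := by
      rw [div_sub_div _ _ h1 h2]
      ring
    have h4 : 1 - r ≤ ‖1 + w * v j‖ := by
      linarith [one_sub_norm_le_norm_one_add_mul (w := w) (hv j)]
    have h5 : 1 - r ≤ ‖1 + w * v' j‖ := by
      linarith [one_sub_norm_le_norm_one_add_mul (w := w) (hv' j)]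
    rw [h3, norm_div, norm_mul, sq]
    have h6 : 0 < 1 - r := sub_pos.mpr hr
    exact div_le_div₀ ((norm_nonneg _).trans (h j)) (h j) (by positivity)
      (mul_le_mul h4 h5 h6.le (norm_nonneg _))
  unfold kernelMean
  rw [← mul_sub, ← Finset.sum_sub_distrib, norm_mul, norm_div, norm_one, Complex.norm_natCast]
  have h7 := (norm_sum_le Finset.univ fun j => v j / (1 + w * v j) - v' j / (1 + w * v' j)).trans
    (Finset.sum_le_card_nsmul _ _ _ fun j _ => hterm j)
  rw [Finset.card_univ, Fintype.card_fin, nsmul_eq_mul] at h7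
  rw [one_div, inv_mul_le_iff₀ hNpos]
  exact h7

/-- Two separated points cannot both make 1 + w v small. The possible exceptional term contributes
at most 2/N, and all others vanish linearly as |w| → 1. This covers the boundary region, where the
Lipschitz bound of `norm_kernelMean_sub_le` degenerates. -/
theorem norm_kernelMean_le_of_separated {N : ℕ} (hN : N ≠ 0) {v : Fin N → ℂ}
    (hv : ∀ j, ‖v j‖ = 1) {κ : ℝ} (hκ : 0 < κ) (hsep : ∀ i j, i ≠ j → κ ≤ ‖v i - v j‖) {w : ℂ}
    (hw : 1 / 2 ≤ ‖w‖) (hw1 : ‖w‖ < 1) :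
    (1 - ‖w‖ ^ 2) * ‖kernelMean v w‖ ≤ 2 / N + 8 * (1 - ‖w‖) / κ := by
  have hNpos : (0 : ℝ) < N := by exact_mod_cast Nat.pos_of_ne_zero hN
  have h2pos : 0 < 1 - ‖w‖ := sub_pos.mpr hw1
  have hsq : 0 < 1 - ‖w‖ ^ 2 := by nlinarith [norm_nonneg w]
  have hterm2 : ∀ j, (1 - ‖w‖ ^ 2) * ‖v j / (1 + w * v j)‖ ≤ 2 := by
    intro j
    have h := one_sub_norm_le_norm_one_add_mul (w := w) (hv j)
    rw [norm_div, hv, ← mul_div_assoc, div_le_iff₀ (h2pos.trans_le h)]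
    nlinarith
  have hfar : ∀ j, κ / 4 ≤ ‖1 + w * v j‖ →
      (1 - ‖w‖ ^ 2) * ‖v j / (1 + w * v j)‖ ≤ 8 * (1 - ‖w‖) / κ := by
    intro j h
    have h' : 0 < ‖1 + w * v j‖ := by linarith
    rw [norm_div, hv, ← mul_div_assoc, mul_one, div_le_div_iff₀ h' hκ]
    nlinarith [mul_le_mul_of_nonneg_left h h2pos.le, mul_pos h2pos hκ, mul_pos h2pos h2pos]
  have huniq : ∀ i j, i ≠ j → κ / 4 ≤ ‖1 + w * v i‖ ∨ κ / 4 ≤ ‖1 + w * v j‖ := by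
    intro i j hij
    by_contra! hcon
    have h1 := norm_sub_le (1 + w * v i) (1 + w * v j)
    have h2 : 1 + w * v i - (1 + w * v j) = w * (v i - v j) := by ring
    rw [h2, norm_mul] at h1
    have h3 := hsep i j hij
    nlinarith [hcon.1, hcon.2, mul_le_mul hw h3 hκ.le (norm_nonneg w)]
  have hB : 0 ≤ 8 * (1 - ‖w‖) / κ := by positivity
  have hsum : ∑ j, (1 - ‖w‖ ^ 2) * ‖v j / (1 + w * v j)‖ ≤ 2 + N * (8 * (1 - ‖w‖) / κ) := by
    by_cases hex : ∃ i, ‖1 + w * v i‖ < κ / 4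
    · obtain ⟨i, hi⟩ := hex
      rw [← Finset.add_sum_erase _ _ (Finset.mem_univ i)]
      refine add_le_add (hterm2 i) ?_
      have h1 := Finset.sum_le_card_nsmul (Finset.univ.erase i)
        (fun j => (1 - ‖w‖ ^ 2) * ‖v j / (1 + w * v j)‖) (8 * (1 - ‖w‖) / κ) (fun j hj =>
          hfar j ((huniq i j (Finset.ne_of_mem_erase hj).symm).resolve_left (not_le.mpr hi)))
      refine h1.trans ?_
      rw [nsmul_eq_mul]
      refine mul_le_mul_of_nonneg_right ?_ hB
      exact_mod_cast (Finset.card_erase_le).trans (by simp)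
    · push Not at hex
      have h1 := Finset.sum_le_card_nsmul Finset.univ
        (fun j => (1 - ‖w‖ ^ 2) * ‖v j / (1 + w * v j)‖) (8 * (1 - ‖w‖) / κ) (fun j _ =>
          hfar j (hex j))
      rw [Finset.card_univ, Fintype.card_fin, nsmul_eq_mul] at h1
      linarith
  unfold kernelMean
  rw [norm_mul, norm_div, norm_one, Complex.norm_natCast]
  have h8 := mul_le_mul_of_nonneg_left (norm_sum_le Finset.univ fun j => v j / (1 + w * v j)) hsq.le
  rw [Finset.mul_sum] at h8
  have h9 := h8.trans hsum
  calc (1 - ‖w‖ ^ 2) * (1 / N * ‖∑ j, v j / (1 + w * v j)‖)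
      = (1 / N) * ((1 - ‖w‖ ^ 2) * ‖∑ j, v j / (1 + w * v j)‖) := by ring
    _ ≤ (1 / N) * (2 + N * (8 * (1 - ‖w‖) / κ)) :=
        mul_le_mul_of_nonneg_left h9 (by positivity)
    _ = 2 / N + 8 * (1 - ‖w‖) / κ := by field_simp

theorem exists_separation {N : ℕ} {ζ : ℂ} (hζ : IsPrimitiveRoot ζ N) :
    ∃ κ > 0, ∀ i j : Fin N, i ≠ j → κ ≤ ‖ζ ^ (i : ℕ) - ζ ^ (j : ℕ)‖ := by
  have hfin : ∀ p : Fin N × Fin N, ∃ κ > 0, p.1 ≠ p.2 → κ ≤ ‖ζ ^ (p.1 : ℕ) - ζ ^ (p.2 : ℕ)‖ := by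
    intro p
    by_cases hp : p.1 = p.2
    · exact ⟨1, one_pos, fun h => absurd hp h⟩
    · refine ⟨_, norm_pos_iff.mpr (sub_ne_zero.mpr fun h => hp ?_), fun _ => le_rfl⟩
      exact Fin.ext (hζ.pow_inj p.1.2 p.2.2 h)
  choose κ hκ hκ' using hfin
  rcases isEmpty_or_nonempty (Fin N × Fin N) with hE | hE
  · exact ⟨1, one_pos, fun i j => (hE.false (i, j)).elim⟩
  · obtain ⟨p, hp⟩ := Finite.exists_min κ
    exact ⟨κ p, hκ p, fun i j hij => (hp (i, j)).trans (hκ' (i, j) hij)⟩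

/-- Near-splay configurations: uniform control of the kernel mean. -/
theorem exists_radius_kernelMean_le {N : ℕ} (hN : N ≠ 0) {ζ : ℂ} (hζ : IsPrimitiveRoot ζ N)
    {r e : ℝ} (hr0 : 0 ≤ r) (hr : r < 1) (he : 0 < e) :
    ∃ η > 0, ∀ (v : Fin N → ℂ) (c : ℂ) (s : Equiv.Perm (Fin N)), (∀ j, ‖v j‖ = 1) → ‖c‖ = 1 →
      (∀ j, ‖v j - c * ζ ^ (s j : ℕ)‖ ≤ η) →
      (∀ w : ℂ, ‖w‖ < 1 → (1 - ‖w‖ ^ 2) * ‖kernelMean v w‖ ≤ 3 / N) ∧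
      ∀ w : ℂ, ‖w‖ ≤ r → ‖kernelMean v w‖ ≤ r ^ (N - 1) / (1 - r ^ N) + e := by
  have hNpos : (0 : ℝ) < N := by exact_mod_cast Nat.pos_of_ne_zero hN
  obtain ⟨κ, hκ, hsep⟩ := exists_separation hζ
  -- Beyond ρ the separation estimate, with separation κ/2, costs only 1/N more than 2/N.
  obtain ⟨ρ, hρ1, hρ2, hρ3⟩ : ∃ ρ : ℝ, 1 / 2 ≤ ρ ∧ ρ < 1 ∧ 8 * (1 - ρ) / (κ / 2) ≤ 1 / N := by
    refine ⟨1 - min (1 / 2) (κ / (16 * N)), ?_, ?_, ?_⟩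
    · linarith [min_le_left (1 / 2) (κ / (16 * N))]
    · have : 0 < min (1 / 2) (κ / (16 * N)) := lt_min (by norm_num) (by positivity)
      linarith
    · rw [sub_sub_cancel, div_le_iff₀ (by positivity)]
      have h := min_le_right (1 / 2) (κ / (16 * N))
      calc 8 * min (1 / 2) (κ / (16 * N)) ≤ 8 * (κ / (16 * N)) := by linarith
        _ = 1 / N * (κ / 2) := by field_simp; norm_num
  have hr' : 0 < 1 - r := sub_pos.mpr hr
  have hρ' : 0 < 1 - ρ := sub_pos.mpr hρ2
  -- The first entry preserves separation κ/2; the others make the Lipschitz error at most e on |w|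
  -- ≤ r and at most 1/N on |w| ≤ ρ.
  refine ⟨min (κ / 4) (min (e * (1 - r) ^ 2) (1 / N * (1 - ρ) ^ 2)),
    lt_min (by positivity) (lt_min (by positivity) (by positivity)), ?_⟩
  intro v c s hv hc hvs
  have hu : ∀ j, ‖c * ζ ^ (s j : ℕ)‖ = 1 := fun j => by
    rw [norm_mul, norm_pow, hc, hζ.norm'_eq_one hN, one_pow, mul_one]
  have hη1 := fun j => (hvs j).trans (min_le_left _ _)
  have hη2 := fun j => (hvs j).trans ((min_le_right _ _).trans (min_le_left _ _))
  have hη3 := fun j => (hvs j).trans ((min_le_right _ _).trans (min_le_right _ _))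
  constructor
  · intro w hw
    rcases le_total ‖w‖ ρ with hwρ | hwρ
    · have h1 := norm_kernelMean_sub_le hN hv hu hη3 hρ2 hwρ
      rw [mul_div_assoc, div_self (by positivity), mul_one] at h1
      have h2 := norm_kernelMean_equidistributed_le hN hζ hc s hw
      have h3 := one_sub_sq_mul_pow_div_le hN (norm_nonneg w) hw
      have hsq : 0 ≤ 1 - ‖w‖ ^ 2 := by nlinarith [norm_nonneg w]
      have h4 : ‖kernelMean v w‖ ≤ 1 / N + ‖w‖ ^ (N - 1) / (1 - ‖w‖ ^ N) := by
        have := norm_le_norm_sub_add (kernelMean v w) (kernelMean (fun j => c * ζ ^ (s j : ℕ)) w)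
        linarith
      have h5 := mul_le_mul_of_nonneg_left h4 hsq
      have h6 : (1 - ‖w‖ ^ 2) * (1 / N) ≤ 1 / N := by
        have : (0 : ℝ) ≤ 1 / N := by positivity
        nlinarith [mul_nonneg this (sq_nonneg ‖w‖)]
      have h7 : (3 : ℝ) / N = 1 / N + 2 / N := by ring
      rw [mul_add] at h5
      linarith
    · have hsep' : ∀ i j, i ≠ j → κ / 2 ≤ ‖v i - v j‖ := by
        intro i j hij
        have h1 := hsep (s i) (s j) (fun h => hij (s.injective h))
        have h2 : c * ζ ^ (s i : ℕ) - c * ζ ^ (s j : ℕ) =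
            (v i - v j) - (v i - c * ζ ^ (s i : ℕ)) + (v j - c * ζ ^ (s j : ℕ)) := by ring
        have h3 : ‖c * ζ ^ (s i : ℕ) - c * ζ ^ (s j : ℕ)‖ = ‖ζ ^ (s i : ℕ) - ζ ^ (s j : ℕ)‖ := by
          rw [← mul_sub, norm_mul, hc, one_mul]
        have h4 := norm_add_le ((v i - v j) - (v i - c * ζ ^ (s i : ℕ))) (v j - c * ζ ^ (s j : ℕ))
        have h5 := norm_sub_le (v i - v j) (v i - c * ζ ^ (s i : ℕ))
        rw [← h2, h3] at h4
        linarith [hη1 i, hη1 j]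
      have h1 := norm_kernelMean_le_of_separated hN hv (half_pos hκ) hsep' (hρ1.trans hwρ) hw
      have h2 : 8 * (1 - ‖w‖) / (κ / 2) ≤ 8 * (1 - ρ) / (κ / 2) := by gcongr
      have h7 : (3 : ℝ) / N = 1 / N + 2 / N := by ring
      linarith
  · intro w hw
    have h1 := norm_kernelMean_sub_le hN hv hu hη2 hr hw
    rw [mul_div_assoc, div_self (by positivity), mul_one] at h1
    have h2 := norm_kernelMean_equidistributed_le hN hζ hc s (hw.trans_lt hr)
    have h3 : ‖w‖ ^ (N - 1) / (1 - ‖w‖ ^ N) ≤ r ^ (N - 1) / (1 - r ^ N) := by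
      have : 0 < 1 - r ^ N := sub_pos.mpr (pow_lt_one₀ hr0 hr hN)
      gcongr
    have := norm_le_norm_sub_add (kernelMean v w) (kernelMean (fun j => c * ζ ^ (s j : ℕ)) w)
    linarith

/-! ### From sup bounds to C^k bounds -/

/-- Cauchy estimates for the real iterated derivatives of a holomorphic function. -/
theorem norm_iteratedFDeriv_real_le {G : ℂ → ℂ} {c : ℂ} {R M : ℝ} (hR : 0 < R) {s : Set ℂ}
    (hs : IsOpen s) (hG : DifferentiableOn ℂ G s) (hcs : Metric.closedBall c R ⊆ s)
    (hM : ∀ z ∈ s, ‖G z‖ ≤ M) (i : ℕ) :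
    ‖iteratedFDeriv ℝ i G c‖ ≤ i.factorial * M / R ^ i := by
  have hc : c ∈ s := hcs (Metric.mem_closedBall_self hR.le)
  have h1 : ContDiffAt ℂ i G c := (hG.contDiffOn hs).contDiffAt (hs.mem_nhds hc)
  rw [← h1.restrictScalars_iteratedFDeriv (𝕜 := ℝ), Function.comp_apply,
    ContinuousMultilinearMap.norm_restrictScalars, norm_iteratedFDeriv_eq_norm_iteratedDeriv]
  refine norm_iteratedDeriv_le_of_forall_mem_sphere_norm_le i hR ?_ fun z hz =>
    hM z (hcs (Metric.sphere_subset_closedBall hz))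
  refine (hG.mono ?_).diffContOnCl
  rwa [closure_ball _ hR.ne']

theorem differentiableOn_kernelMean {N : ℕ} {v : Fin N → ℂ} (hv : ∀ j, ‖v j‖ = 1) :
    DifferentiableOn ℂ (kernelMean v) (Metric.ball 0 1) := by
  unfold kernelMean
  refine DifferentiableOn.const_mul (DifferentiableOn.fun_sum fun j _ => ?_) _
  refine DifferentiableOn.div (by fun_prop) (by fun_prop) fun w hw => ?_
  exact one_add_mul_ne_zero (hv j) (by simpa using hw)

/-- A sup bound for a holomorphic `G` on a larger disc controls the `C^k` norm of
`α ↦ (1 - α conj α) G (conj α)`, linearly and uniformly in `G`. -/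
theorem exists_ckNormLE_const (k : ℕ) {r r' : ℝ} (hrr : r < r') :
    ∃ C > 0, ∀ (G : ℂ → ℂ) (M : ℝ), 0 ≤ M → DifferentiableOn ℂ G (Metric.ball 0 r') →
      (∀ w ∈ Metric.ball (0 : ℂ) r', ‖G w‖ ≤ M) →
      CkNormLE k r (C * M) (fun α => (1 - α * conj α) * G (conj α)) := by
  set B := Metric.ball (0 : ℂ) r with hB
  have hBo : IsOpen B := Metric.isOpen_ball
  have hp : ContDiff ℝ k fun α : ℂ => 1 - α * conj α := by
    have : ContDiff ℝ k fun α : ℂ => conj α := conjCLE.contDiff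
    fun_prop
  have hbd : ∀ i : ℕ, ∃ A : ℝ, 0 ≤ A ∧ (i ≤ k → ∀ α ∈ B,
      ‖iteratedFDeriv ℝ i (fun α : ℂ => 1 - α * conj α) α‖ ≤ A) := by
    intro i
    by_cases hi : i ≤ k
    · obtain ⟨A, hA⟩ := (isCompact_closedBall (0 : ℂ) r).exists_bound_of_continuousOn
        (hp.continuous_iteratedFDeriv (m := i) (by exact_mod_cast hi)).continuousOn
      exact ⟨max A 0, le_max_right _ _, fun _ α hα =>
        (hA α (Metric.ball_subset_closedBall hα)).trans (le_max_left _ _)⟩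
    · exact ⟨0, le_rfl, fun h => absurd h hi⟩
  choose A hA0 hA using hbd
  -- Closed discs of radius R about points of the smaller disc stay inside the larger one.
  set R := (r' - r) / 2 with hRdef
  have hR : 0 < R := by rw [hRdef]; linarith
  set S : ℕ → ℝ := fun i => ∑ m ∈ Finset.range (i + 1),
    (i.choose m : ℝ) * A m * ((i - m).factorial / R ^ (i - m)) with hS
  have hS0 : ∀ i, 0 ≤ S i := fun i => Finset.sum_nonneg fun m _ => by
    have := hA0 m
    positivity
  refine ⟨∑ i ∈ Finset.range (k + 1), S i + 1, by
    have := Finset.sum_nonneg fun i (_ : i ∈ Finset.range (k + 1)) => hS0 i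
    linarith, ?_⟩
  intro G M hM0 hG hGM
  have hGc : ContDiffOn ℝ k (fun α : ℂ => G (conj α)) B := by
    have h1 : ContDiffOn ℝ k G (Metric.ball 0 r') :=
      (hG.contDiffOn Metric.isOpen_ball).restrict_scalars ℝ
    refine h1.comp conjCLE.contDiff.contDiffOn fun α hα => ?_
    simp only [hB, Metric.mem_ball, dist_zero_right] at hα
    simpa using hα.trans hrr
  have hGd : ∀ i, ∀ α ∈ B, ‖iteratedFDeriv ℝ i (fun α : ℂ => G (conj α)) α‖ ≤
      i.factorial * M / R ^ i := by
    intro i α hα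
    -- Conjugation destroys holomorphy, but as a real-linear isometry it preserves the norms of real
    -- derivatives.
    have h1 := conjLIE.norm_iteratedFDeriv_comp_right G α i
    have h2 : (G ∘ conjLIE : ℂ → ℂ) = fun α : ℂ => G (conj α) := rfl
    rw [h2] at h1
    rw [h1]
    refine norm_iteratedFDeriv_real_le hR Metric.isOpen_ball hG (fun z hz => ?_) hGM i
    simp only [hB, Metric.mem_ball, dist_zero_right] at hα
    rw [mem_closedBall_iff_norm] at hz
    rw [mem_ball_zero_iff]
    have h3 := norm_le_norm_sub_add z (conjLIE α)
    have h4 : ‖conjLIE α‖ = ‖α‖ := conjLIE.norm_map α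
    linarith
  refine ⟨hp.contDiffOn.mul hGc, fun i hi α hα => ?_⟩
  have h1 := norm_iteratedFDerivWithin_mul_le (N := k) hp.contDiffOn hGc hBo.uniqueDiffOn hα
    (n := i) (by exact_mod_cast hi)
  simp only [iteratedFDerivWithin_of_isOpen _ hBo hα] at h1
  refine h1.trans ?_
  have h2 : S i ≤ ∑ i ∈ Finset.range (k + 1), S i + 1 := by
    have := Finset.single_le_sum (fun i _ => hS0 i) (Finset.mem_range.mpr (Nat.lt_succ_of_le hi))
    linarith
  refine le_trans ?_ (mul_le_mul_of_nonneg_right h2 hM0)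
  rw [hS, Finset.sum_mul]
  refine Finset.sum_le_sum fun m hm => ?_
  have hmk : m ≤ k := (Nat.lt_succ_iff.mp (Finset.mem_range.mp hm)).trans hi
  calc (i.choose m : ℝ) * ‖iteratedFDeriv ℝ m (fun α : ℂ => 1 - α * conj α) α‖ *
        ‖iteratedFDeriv ℝ (i - m) (fun α : ℂ => G (conj α)) α‖
      ≤ (i.choose m : ℝ) * A m * ((i - m).factorial * M / R ^ (i - m)) := by
        have := hA m hmk α hα
        have := hGd (i - m) α hα
        have := hA0 m
        gcongr
    _ = _ := by ring

theorem CkNormLE.congr {k : ℕ} {r ε : ℝ} {F F' : ℂ → ℂ} (h : CkNormLE k r ε F)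
    (hF : EqOn F' F (Metric.ball 0 r)) : CkNormLE k r ε F' := by
  refine ⟨h.1.congr hF, fun i hi α hα => ?_⟩
  have h1 := Metric.isOpen_ball.mem_nhds hα
  rw [((hF.eventuallyEq_of_mem h1).iteratedFDeriv ℝ i).eq_of_nhds]
  exact h.2 i hi α hα

/-! ### A barrier argument and the averaging corrector -/

/-- If `W' ≤ -m` whenever `W ≥ w`, then `W ≤ w` after an explicit time. -/
theorem le_of_deriv_le_neg_above {W W' : ℝ → ℝ} {w b m T : ℝ} (hm : 0 < m)
    (hW : ∀ t, 0 ≤ t → HasDerivWithinAt W (W' t) (Ici 0) t)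
    (hW' : ∀ t, 0 ≤ t → w ≤ W t → W' t ≤ -m) (hb : 0 ≤ b) (h0 : W 0 ≤ w + b)
    (hT : T = 2 * b / m) {t : ℝ} (ht : T ≤ t) : W t ≤ w := by
  have hT0 : 0 ≤ T := by rw [hT]; positivity
  have hcont : ContinuousOn W (Ici 0) := fun t ht => (hW t ht).continuousWithinAt
  have hWr : ∀ t, 0 ≤ t → HasDerivWithinAt W (W' t) (Ici t) t := fun t ht =>
    (hW t ht).mono (Ici_subset_Ici.mpr ht)
  have h1 : W T ≤ w := by
    -- The barrier falls with slope -m/2, strictly slower than W does on contact, and reaches w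
    -- exactly at T.
    have h := image_le_of_deriv_right_lt_deriv_boundary (f := W) (f' := W') (a := 0) (b := T)
      (B := fun t => w + b - m / 2 * t) (B' := fun _ => -(m / 2))
      (hcont.mono Icc_subset_Ici_self) (fun x hx => hWr x hx.1) (by simpa using h0)
      (fun x => by
        have := ((hasDerivAt_id x).const_mul (m / 2)).const_sub (w + b)
        simpa using this)
      (fun x hx hxB => by
        have hle : w ≤ W x := by
          rw [hxB]
          have : m / 2 * x ≤ m / 2 * T := by nlinarith [hx.2]
          have h2 : m / 2 * T = b := by rw [hT]; field_simp
          linarith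
        linarith [hW' x hx.1 hle])
      (right_mem_Icc.mpr hT0)
    have h2 : m / 2 * T = b := by rw [hT]; field_simp
    linarith
  exact image_le_of_deriv_right_lt_deriv_boundary (f := W) (f' := W') (a := T) (b := t)
    (B := fun _ => w) (B' := fun _ => 0)
    (hcont.mono fun x hx => hT0.trans hx.1) (fun x hx => hWr x (hT0.trans hx.1)) h1
    (fun x => hasDerivAt_const x w)
    (fun x hx hxB => by linarith [hW' x (hT0.trans hx.1) hxB.ge])
    (right_mem_Icc.mpr ht)

/-- The averaging corrector, a function of `X + iZ = σ e^{iδ} α`. -/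
def corrector (δ X Z : ℝ) : ℝ :=
  Real.cos (2 * δ) * Real.log (1 + Z) + Real.sin (2 * δ) * (-X + X * Z / 4)

/-- The constant controlling the corrector and its derivatives. -/
def correctorConst (σ : ℝ) : ℝ := 2 / (1 - σ) + 5

theorem correctorConst_pos {σ : ℝ} (hσ : σ < 1) : 0 < correctorConst σ := by
  have : 0 < 1 - σ := sub_pos.mpr hσ
  unfold correctorConst
  positivity

theorem abs_corrector_le {σ δ X Z : ℝ} (hσ : σ < 1) (hX : |X| ≤ σ) (hZ : |Z| ≤ σ) :
    |corrector δ X Z| ≤ correctorConst σ := by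
  have h1σ : 0 < 1 - σ := sub_pos.mpr hσ
  have hX' := abs_le.mp hX
  have hZ' := abs_le.mp hZ
  have hpos : 0 < 1 + Z := by linarith
  have hinv : 0 < 1 / (1 - σ) := by positivity
  have hlog : |Real.log (1 + Z)| ≤ 1 / (1 - σ) + 1 := by
    rw [abs_le]
    constructor
    · have h1 := Real.one_sub_inv_le_log_of_pos hpos
      have h2 : (1 + Z)⁻¹ ≤ 1 / (1 - σ) := by
        rw [← one_div]
        exact one_div_le_one_div_of_le h1σ (by linarith)
      linarith
    · linarith [Real.log_le_sub_one_of_pos hpos]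
  have hq : |-X + X * Z / 4| ≤ 2 := by
    have h1 : |X * Z| ≤ 1 := by
      rw [abs_mul]
      nlinarith [abs_nonneg X, abs_nonneg Z]
    have := abs_le.mp h1
    rw [abs_le]
    constructor <;> linarith
  have ha : |Real.cos (2 * δ) * Real.log (1 + Z)| ≤ 1 / (1 - σ) + 1 := by
    rw [abs_mul]
    nlinarith [Real.abs_cos_le_one (2 * δ), abs_nonneg (Real.log (1 + Z))]
  have hb : |Real.sin (2 * δ) * (-X + X * Z / 4)| ≤ 2 := by
    rw [abs_mul]
    nlinarith [Real.abs_sin_le_one (2 * δ), abs_nonneg (-X + X * Z / 4)]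
  have h := abs_add_le (Real.cos (2 * δ) * Real.log (1 + Z))
    (Real.sin (2 * δ) * (-X + X * Z / 4))
  have h2 : correctorConst σ = 2 * (1 / (1 - σ)) + 5 := by unfold correctorConst; ring
  unfold corrector
  linarith

/-- Under the leading rotation of speed -β(1 + Z), log(1 + Z)/β has derivative -X and cancels c X
exactly. The term -X/β cancels Z and leaves -Z². Adding XZ/(4β) spreads this over both coordinates,
giving a negative definite form for |Z| < 1. -/
theorem lyapunov_drift_eq {c s X Z h₁ h₂ e β : ℝ} (hZ : 1 + Z ≠ 0) (hβ : β ≠ 0) :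
    c * X + s * Z + 1 / β * (c * (((1 - β * (1 + Z + e)) * X + h₂) / (1 + Z)) +
      s * (-(-(1 - β * (1 + Z + e)) * Z + h₁) + ((-(1 - β * (1 + Z + e)) * Z + h₁) * Z +
        X * ((1 - β * (1 + Z + e)) * X + h₂)) / 4)) =
      -(s / 4 * ((X ^ 2 + Z ^ 2) * (1 + Z) + 2 * Z ^ 2 * (1 - Z))) +
        (1 / β) * (c * X * (1 / (1 + Z)) + s * (Z + (X ^ 2 - Z ^ 2) / 4) +
          h₂ * (c * (1 / (1 + Z)) + s * (X / 4)) + h₁ * (s * (-1 + Z / 4))) -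
        e * (c * X * (1 / (1 + Z)) + s * (Z + (X ^ 2 - Z ^ 2) / 4)) := by
  field_simp
  ring

/-- The drift of the corrected Lyapunov function: `h₁ + i h₂` is the part of the velocity of
`X + iZ` other than the rotation with speed `1 - β (1 + Z + e)`. -/
theorem lyapunov_drift_le {σ c s X Z h₁ h₂ e η β : ℝ} (hσ : σ < 1) (hc : |c| ≤ 1)
    (hs0 : 0 ≤ s) (hs : s ≤ 1) (hX : |X| ≤ σ) (hZ : |Z| ≤ σ) (h1 : |h₁| ≤ 1) (h2 : |h₂| ≤ 1)
    (he : |e| ≤ η) (hβ : 0 < β) :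
    c * X + s * Z + 1 / β * (c * (((1 - β * (1 + Z + e)) * X + h₂) / (1 + Z)) +
      s * (-(-(1 - β * (1 + Z + e)) * Z + h₁) + ((-(1 - β * (1 + Z + e)) * Z + h₁) * Z +
        X * ((1 - β * (1 + Z + e)) * X + h₂)) / 4)) ≤
    -(s / 4 * (1 - σ) * (X ^ 2 + Z ^ 2)) + correctorConst σ * (1 / β + η) := by
  have h1σ : 0 < 1 - σ := sub_pos.mpr hσ
  have hX' := abs_le.mp hX
  have hZ' := abs_le.mp hZ
  have hpos : 0 < 1 + Z := by linarith
  have hXone : |X| ≤ 1 := hX.trans hσ.le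
  have hZone : |Z| ≤ 1 := hZ.trans hσ.le
  have hη : 0 ≤ η := (abs_nonneg e).trans he
  set d := 1 / (1 - σ) with hd
  have hd0 : 0 < d := by positivity
  have hinv : 1 / (1 + Z) ≤ d := one_div_le_one_div_of_le h1σ (by linarith)
  have hinv0 : 0 < 1 / (1 + Z) := by positivity
  set q := 1 / (1 + Z) with hqdef
  have hsabs : |s| ≤ 1 := by rwa [abs_of_nonneg hs0]
  have hmul : ∀ {x y a b : ℝ}, |x| ≤ a → |y| ≤ b → |x * y| ≤ a * b := fun hx hy => by
    rw [abs_mul]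
    exact mul_le_mul hx hy (abs_nonneg _) ((abs_nonneg _).trans hx)
  have hqabs : |q| ≤ d := by rwa [abs_of_pos hinv0]
  set Rt := c * X * q + s * (Z + (X ^ 2 - Z ^ 2) / 4) with hRt
  have hsq : |Z + (X ^ 2 - Z ^ 2) / 4| ≤ 2 := by
    have ha := hmul hXone hXone
    have hb := hmul hZone hZone
    rw [abs_le] at ha hb ⊢
    have := abs_le.mp hZone
    constructor <;> linarith [ha.1, ha.2, hb.1, hb.2]
  have hRabs : |Rt| ≤ d + 2 := by
    have ha := hmul (hmul hc hXone) hqabs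
    have hb := hmul hsabs hsq
    have := abs_add_le (c * X * q) (s * (Z + (X ^ 2 - Z ^ 2) / 4))
    rw [hRt]
    linarith
  have hP : |h₂ * (c * q + s * (X / 4))| ≤ d + 1 := by
    have hX4 : |X / 4| ≤ 1 := by rw [abs_le] at hXone ⊢; constructor <;> linarith
    have ha := hmul hc hqabs
    have hb := hmul hsabs hX4
    have := abs_add_le (c * q) (s * (X / 4))
    have hh : |c * q + s * (X / 4)| ≤ d + 1 := by linarith
    have := hmul h2 hh
    linarith
  have hQ : |h₁ * (s * (-1 + Z / 4))| ≤ 2 := by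
    have hZ4 : |-1 + Z / 4| ≤ 2 := by rw [abs_le] at hZone ⊢; constructor <;> linarith
    have := hmul h1 (hmul hsabs hZ4)
    linarith
  have heR := hmul he hRabs
  have hkey := lyapunov_drift_eq (c := c) (s := s) (X := X) (h₁ := h₁) (h₂ := h₂) (e := e)
    hpos.ne' hβ.ne'
  rw [← hqdef, ← hRt] at hkey
  rw [hkey]
  have hmain : s / 4 * (1 - σ) * (X ^ 2 + Z ^ 2) ≤
      s / 4 * ((X ^ 2 + Z ^ 2) * (1 + Z) + 2 * Z ^ 2 * (1 - Z)) := by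
    rw [mul_assoc]
    refine mul_le_mul_of_nonneg_left ?_ (by linarith)
    have ha : 0 ≤ (X ^ 2 + Z ^ 2) * (Z + σ) := mul_nonneg (by positivity) (by linarith)
    have hb : 0 ≤ Z ^ 2 * (1 - Z) := mul_nonneg (sq_nonneg Z) (by linarith)
    nlinarith
  have hsum : Rt + h₂ * (c * q + s * (X / 4)) + h₁ * (s * (-1 + Z / 4)) ≤ 2 * d + 5 := by
    linarith [le_abs_self Rt, le_abs_self (h₂ * (c * q + s * (X / 4))),
      le_abs_self (h₁ * (s * (-1 + Z / 4)))]
  have hsum' := mul_le_mul_of_nonneg_left hsum (one_div_pos.mpr hβ).le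
  have hC : correctorConst σ = 2 * d + 5 := by unfold correctorConst; rw [hd]; ring
  rw [hC]
  have h3 := neg_abs_le (e * Rt)
  have h4 := mul_nonneg hη hd0.le
  have h5 : (2 * d + 5) * (1 / β + η) = 1 / β * (2 * d + 5) + (η * (d + 2) + (η * d + 3 * η)) := by
    ring
  rw [h5]
  linarith

/-! ### The velocity field in the coordinate Y -/

theorem I_mul_wsF (σ δ : ℝ) : I * wsF σ δ = -(σ : ℂ) * exp (-(δ * I)) / 2 := by
  unfold wsF
  have := I_ne_zero
  field_simp

theorem I_mul_conj_wsF (σ δ : ℝ) : I * conj (wsF σ δ) = (σ : ℂ) * exp (δ * I) / 2 := by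
  have h := congrArg conj (I_mul_wsF σ δ)
  simp only [map_mul, map_div₀, map_neg, conj_I, conj_ofReal, ← exp_conj, map_ofNat, mul_neg,
    neg_neg, neg_mul] at h
  linear_combination -h

/-- The Watanabe–Strogatz velocity in the rotated and scaled coordinate `Y = σ e^{iδ} α`. -/
theorem IsSolution.hasDerivWithinAt_scaled {σ δ β : ℝ} {N : ℕ} {θ : Fin N → Real.Angle}
    {α : ℝ → ℂ} {ψ : ℝ → ℝ} (h : IsSolution σ δ β θ α ψ) {t : ℝ} (ht : 0 ≤ t) :
    HasDerivWithinAt (fun t => σ * exp (δ * I) * α t)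
      (I * (wsG σ δ β (orderParam (α t) (ψ t) θ) : ℂ) * (σ * exp (δ * I) * α t) +
        ((σ : ℂ) ^ 2 * exp (((2 * δ : ℝ) : ℂ) * I) -
          conj (exp (((2 * δ : ℝ) : ℂ) * I)) * (σ * exp (δ * I) * α t) ^ 2) / 2) (Ici 0) t := by
  refine ((h t ht).2.1.const_mul (σ * exp (δ * I))).congr_deriv ?_
  have h1 : exp (((2 * δ : ℝ) : ℂ) * I) = exp (δ * I) ^ 2 := by
    rw [← exp_nat_mul]
    push_cast
    ring_nf
  have h2 : conj (exp (δ * I)) = exp (-(δ * I)) := by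
    rw [← exp_conj, map_mul, conj_ofReal, conj_I, mul_neg]
  have h3 : exp (-(δ * I)) * exp (δ * I) = 1 := by rw [← exp_add, neg_add_cancel, exp_zero]
  have h4 := I_mul_wsF σ δ
  have h5 := I_mul_conj_wsF σ δ
  rw [h1, map_pow, h2]
  generalize wsF σ δ = f at *
  generalize exp (δ * I) = E at *
  generalize exp (-(δ * I)) = E' at *
  linear_combination (σ * E * α t ^ 2) * h4 + (σ * E) * h5 +
    ((σ : ℂ) ^ 2 * α t ^ 2 * (E' * E) / 2) * h3

/-- Applied with a = α, this separates the rotation speed determined by Y alone from the error e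
caused by z ≠ α. -/
theorem wsG_eq (σ δ β : ℝ) (z a : ℂ) :
    wsG σ δ β z = 1 - β * (1 + (σ * exp (δ * I) * a).im + σ * ((z - a) * exp (δ * I)).im) := by
  have h : (σ * exp (δ * I) * a).im = σ * (a * exp (δ * I)).im := by
    rw [mul_assoc, mul_comm (exp _), im_ofReal_mul]
  rw [h, sub_mul, sub_im, wsG]
  ring

/-! ### Radial energy and attraction towards the origin -/

/-- The energy `-log (1 - ρ²)` of the radius `ρ`. -/
def radialEnergy (ρ : ℝ) : ℝ := -Real.log (1 - ρ ^ 2)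

theorem radialEnergy_lt {a b : ℝ} (ha : 0 ≤ a) (hab : a < b) (hb : b < 1) :
    radialEnergy a < radialEnergy b := by
  unfold radialEnergy
  exact neg_lt_neg (Real.log_lt_log (by nlinarith) (by nlinarith))

theorem radialEnergy_le {a b : ℝ} (ha : 0 ≤ a) (hab : a ≤ b) (hb : b < 1) :
    radialEnergy a ≤ radialEnergy b := by
  rcases hab.eq_or_lt with rfl | h
  · exact le_rfl
  · exact (radialEnergy_lt ha h hb).le

theorem radialEnergy_nonneg {a : ℝ} (ha : 0 ≤ a) (h1 : a < 1) : 0 ≤ radialEnergy a := by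
  have := radialEnergy_le le_rfl ha h1
  rwa [radialEnergy, zero_pow two_ne_zero, sub_zero, Real.log_one, neg_zero] at this

/-- The rate at which the corrected energy decays where `|α| ≥ r / 2`. -/
def decayRate (σ δ r : ℝ) : ℝ := Real.sin (2 * δ) / 8 * (1 - σ) * (σ ^ 2 * (r / 2) ^ 2)

theorem decayRate_pos {σ δ r : ℝ} (hδ : 0 < δ) (hδ' : δ < Real.pi / 4) (hσ : 0 < σ) (hσ' : σ < 1)
    (hr : 0 < r) : 0 < decayRate σ δ r := by
  have h1 : 0 < Real.sin (2 * δ) := Real.sin_pos_of_pos_of_lt_pi (by linarith) (by linarith)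
  have h2 : 0 < 1 - σ := sub_pos.mpr hσ'
  unfold decayRate
  positivity

/-- The radial energy of `α`, corrected for averaging over the phase of `Y = σ e^{iδ} α`. -/
def lyapunov (σ δ β : ℝ) (Y : ℂ) : ℝ :=
  -Real.log (1 - (Y.re ^ 2 + Y.im ^ 2) / σ ^ 2) + 1 / β * corrector δ Y.re Y.im

theorem hasDerivWithinAt_lyapunov {σ δ β : ℝ} {Y : ℝ → ℂ} {Y' : ℂ} {s : Set ℝ} {t : ℝ}
    (hY : HasDerivWithinAt Y Y' s t) (h1 : 1 + (Y t).im ≠ 0)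
    (h2 : 1 - ((Y t).re ^ 2 + (Y t).im ^ 2) / σ ^ 2 ≠ 0) :
    HasDerivWithinAt (fun t => lyapunov σ δ β (Y t))
      (2 * ((Y t).re * Y'.re + (Y t).im * Y'.im) / σ ^ 2 /
          (1 - ((Y t).re ^ 2 + (Y t).im ^ 2) / σ ^ 2) +
        1 / β * (Real.cos (2 * δ) * (Y'.im / (1 + (Y t).im)) +
          Real.sin (2 * δ) * (-Y'.re + (Y'.re * (Y t).im + (Y t).re * Y'.im) / 4))) s t := by
  have hX : HasDerivWithinAt (fun t => (Y t).re) Y'.re s t :=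
    reCLM.hasFDerivAt.comp_hasDerivWithinAt t hY
  have hZ : HasDerivWithinAt (fun t => (Y t).im) Y'.im s t :=
    imCLM.hasFDerivAt.comp_hasDerivWithinAt t hY
  have hQ := ((((hX.pow 2).add (hZ.pow 2)).div_const (σ ^ 2)).const_sub 1).log h2
  have hC := (((hZ.const_add 1).log h1).const_mul (Real.cos (2 * δ))).add
    ((hX.neg.add ((hX.mul hZ).div_const 4)).const_mul (Real.sin (2 * δ)))
  refine (hQ.neg.add (hC.const_mul (1 / β))).congr_deriv ?_
  simp only [Pi.add_apply, Pi.pow_apply]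
  ring

/-- Attraction of the slow dynamics: if the order parameter stays `η`-close to `α`, the modulus of
`α` eventually drops below `r`. -/
theorem exists_time_norm_le {σ δ r ρ β η : ℝ} (hδ : 0 < δ) (hδ' : δ < Real.pi / 4) (hσ : 0 < σ)
    (hσ' : σ < 1) (hr : 0 < r) (hr1 : r < 1) (hρ : 0 ≤ ρ) (hρ1 : ρ < 1) (hβ : 0 < β)
    (hgap : 2 * correctorConst σ / β ≤ radialEnergy r - radialEnergy (r / 2))
    (hrate : correctorConst σ * (1 / β + η) ≤ decayRate σ δ r) :
    ∃ T > 0, ∀ (N : ℕ) (θ : Fin N → Real.Angle) (α : ℝ → ℂ) (ψ : ℝ → ℝ),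
      IsSolution σ δ β θ α ψ → (∀ t, 0 ≤ t → ‖orderParam (α t) (ψ t) θ - α t‖ ≤ η) →
      ‖α 0‖ ≤ ρ → ∀ t, T ≤ t → ‖α t‖ ≤ r := by
  set K := correctorConst σ with hKdef
  have hK : 0 < K := correctorConst_pos hσ'
  set m := decayRate σ δ r with hm
  have hmpos : 0 < m := decayRate_pos hδ hδ' hσ hσ' hr
  have hL0 : 0 ≤ radialEnergy ρ := radialEnergy_nonneg hρ hρ1
  -- The summand 1 only ensures positivity, since the energy vanishes for ρ = 0.
  refine ⟨2 * radialEnergy ρ / m + 1, by positivity, ?_⟩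
  intro N θ α ψ hsol hz h0 t ht
  set Y : ℝ → ℂ := fun t => σ * exp (δ * I) * α t with hYdef
  have hYnorm : ∀ t, ‖Y t‖ = σ * ‖α t‖ := fun t => by
    rw [hYdef]
    simp only [norm_mul, norm_exp_ofReal_mul_I, norm_real, Real.norm_eq_abs, abs_of_pos hσ, mul_one]
  have hq : ∀ t, (Y t).re ^ 2 + (Y t).im ^ 2 = σ ^ 2 * ‖α t‖ ^ 2 := fun t => by
    rw [← mul_pow, ← hYnorm, ← normSq_eq_norm_sq, normSq_apply, sq, sq]
  have hqdiv : ∀ t, ((Y t).re ^ 2 + (Y t).im ^ 2) / σ ^ 2 = ‖α t‖ ^ 2 := fun t => by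
    rw [hq, mul_div_cancel_left₀ _ (by positivity)]
  have hre : ∀ t, 0 ≤ t → |(Y t).re| ≤ σ := fun t ht => (abs_re_le_norm _).trans (by
    rw [hYnorm]; nlinarith [(hsol t ht).1])
  have him : ∀ t, 0 ≤ t → |(Y t).im| ≤ σ := fun t ht => (abs_im_le_norm _).trans (by
    rw [hYnorm]; nlinarith [(hsol t ht).1])
  have hsub : ∀ t, 0 ≤ t → 0 < 1 - ‖α t‖ ^ 2 := fun t ht => by
    nlinarith [(hsol t ht).1, norm_nonneg (α t)]
  have hcorr : ∀ t, 0 ≤ t → |1 / β * corrector δ (Y t).re (Y t).im| ≤ K / β := by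
    intro t ht
    rw [abs_mul, abs_of_pos (one_div_pos.mpr hβ), div_eq_mul_one_div K, mul_comm]
    exact mul_le_mul_of_nonneg_right (abs_corrector_le hσ' (hre t ht) (him t ht))
      (one_div_pos.mpr hβ).le
  have hWeq : ∀ t, lyapunov σ δ β (Y t) =
      radialEnergy ‖α t‖ + 1 / β * corrector δ (Y t).re (Y t).im := fun t => by
    rw [lyapunov, hqdiv, radialEnergy]
  set g : ℝ → ℝ := fun t => wsG σ δ β (orderParam (α t) (ψ t) θ) with hg
  set e : ℝ → ℝ := fun t =>
    σ * ((orderParam (α t) (ψ t) θ - α t) * exp (δ * I)).im with hedef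
  have hge : ∀ t, g t = 1 - β * (1 + (Y t).im + e t) := fun t => wsG_eq σ δ β _ (α t)
  have he : ∀ t, 0 ≤ t → |e t| ≤ η := fun t ht => by
    rw [hedef]
    simp only [abs_mul, abs_of_pos hσ]
    have h1 := abs_im_le_norm ((orderParam (α t) (ψ t) θ - α t) * exp (δ * I))
    rw [norm_mul, norm_exp_ofReal_mul_I, mul_one] at h1
    have h2 := h1.trans (hz t ht)
    nlinarith [abs_nonneg ((orderParam (α t) (ψ t) θ - α t) * exp (δ * I)).im]
  set h : ℝ → ℂ := fun t => ((σ : ℂ) ^ 2 * exp (((2 * δ : ℝ) : ℂ) * I) -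
    conj (exp (((2 * δ : ℝ) : ℂ) * I)) * Y t ^ 2) / 2 with hh
  have hhnorm : ∀ t, 0 ≤ t → ‖h t‖ ≤ 1 := by
    intro t ht
    have h1 := norm_sub_le ((σ : ℂ) ^ 2 * exp (((2 * δ : ℝ) : ℂ) * I))
      (conj (exp (((2 * δ : ℝ) : ℂ) * I)) * Y t ^ 2)
    rw [norm_mul, norm_mul, norm_conj, norm_exp_ofReal_mul_I, norm_pow, norm_pow, hYnorm,
      norm_real, Real.norm_eq_abs, abs_of_pos hσ] at h1
    have h2 : (σ * ‖α t‖) ^ 2 ≤ 1 := by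
      have := (hsol t ht).1
      exact pow_le_one₀ (by positivity) (by nlinarith [norm_nonneg (α t)])
    have h3 : σ ^ 2 ≤ 1 := pow_le_one₀ hσ.le hσ'.le
    rw [hh]
    simp only [norm_div, norm_ofNat]
    linarith
  have hhre : ∀ t, (h t).re = (σ ^ 2 * Real.cos (2 * δ) - (Real.cos (2 * δ) *
      ((Y t).re ^ 2 - (Y t).im ^ 2) + 2 * Real.sin (2 * δ) * (Y t).re * (Y t).im)) / 2 := by
    intro t
    rw [hh]
    simp only [exp_ofReal_mul_I_re, exp_ofReal_mul_I_im, sub_re, mul_re, conj_re,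
      conj_im, div_ofNat_re, sq, ofReal_re, ofReal_im, mul_im]
    ring
  have hhim : ∀ t, (h t).im = (σ ^ 2 * Real.sin (2 * δ) - (Real.cos (2 * δ) *
      (2 * (Y t).re * (Y t).im) - Real.sin (2 * δ) * ((Y t).re ^ 2 - (Y t).im ^ 2))) / 2 := by
    intro t
    rw [hh]
    simp only [exp_ofReal_mul_I_re, exp_ofReal_mul_I_im, sub_im, mul_re, conj_re,
      conj_im, div_ofNat_im, sq, ofReal_re, ofReal_im, mul_im]
    ring
  set V : ℝ → ℂ := fun t => I * (g t : ℂ) * Y t + h t with hV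
  have hVre : ∀ t, (V t).re = -(g t) * (Y t).im + (h t).re := fun t => by
    simp [hV]
  have hVim : ∀ t, (V t).im = g t * (Y t).re + (h t).im := fun t => by
    simp [hV]
  have hY : ∀ t, 0 ≤ t → HasDerivWithinAt Y (V t) (Ici 0) t := fun t ht =>
    hsol.hasDerivWithinAt_scaled ht
  -- The corrector is at most K/β in size, so above this level |α| ≥ r/2, while below it `hgap`
  -- forces |α| ≤ r.
  have hbd := le_of_deriv_le_neg_above (W := fun t => lyapunov σ δ β (Y t))
    (w := radialEnergy (r / 2) + K / β) (b := radialEnergy ρ) hmpos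
    (fun t ht => hasDerivWithinAt_lyapunov (β := β) (hY t ht)
      (by have := abs_le.mp (him t ht); linarith) (by rw [hqdiv]; exact (hsub t ht).ne'))
    ?_ hL0 ?_ rfl (t := t) (by linarith)
  · have ht0 : 0 ≤ t := by
      have : 0 ≤ 2 * radialEnergy ρ / m := by positivity
      linarith
    simp only [hWeq] at hbd
    have h1 := (abs_le.mp (hcorr t ht0)).1
    by_contra! hlt
    have h2 := radialEnergy_lt hr.le hlt (hsol t ht0).1
    have h3 : 2 * K / β = K / β + K / β := by ring
    linarith
  · intro t ht hw
    simp only [hWeq] at hw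
    have h1 := (abs_le.mp (hcorr t ht)).2
    have h2 : r / 2 ≤ ‖α t‖ := by
      by_contra! hlt
      have := radialEnergy_lt (norm_nonneg _) hlt (by linarith)
      linarith
    -- The rotation is orthogonal to Y, and the radial part of h carries the factor 1 - |α|², which
    -- cancels the denominator.
    have hrad : 2 * ((Y t).re * (V t).re + (Y t).im * (V t).im) / σ ^ 2 /
        (1 - ((Y t).re ^ 2 + (Y t).im ^ 2) / σ ^ 2) =
        Real.cos (2 * δ) * (Y t).re + Real.sin (2 * δ) * (Y t).im := by
      have hs := (hsub t ht).ne'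
      rw [← hqdiv] at hs
      rw [div_eq_iff hs, hVre, hVim, hhre, hhim]
      field_simp
      ring
    rw [hrad, hVre, hVim, hge]
    have hsin0 : 0 < Real.sin (2 * δ) :=
      Real.sin_pos_of_pos_of_lt_pi (by linarith) (by linarith)
    refine (lyapunov_drift_le hσ' (Real.abs_cos_le_one (2 * δ)) hsin0.le (Real.sin_le_one _)
      (hre t ht) (him t ht) ((abs_re_le_norm _).trans (hhnorm t ht))
      ((abs_im_le_norm _).trans (hhnorm t ht)) (he t ht) hβ).trans ?_
    have h3 : σ ^ 2 * (r / 2) ^ 2 ≤ (Y t).re ^ 2 + (Y t).im ^ 2 := by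
      rw [hq]
      gcongr
    have h4 : Real.sin (2 * δ) / 4 * (1 - σ) * (σ ^ 2 * (r / 2) ^ 2) ≤
        Real.sin (2 * δ) / 4 * (1 - σ) * ((Y t).re ^ 2 + (Y t).im ^ 2) :=
      mul_le_mul_of_nonneg_left h3 (mul_nonneg (by linarith) (by linarith))
    -- The available decay is twice m; `hrate` lets the errors consume one half.
    have h5 : Real.sin (2 * δ) / 4 * (1 - σ) * (σ ^ 2 * (r / 2) ^ 2) = 2 * m := by
      rw [hm, decayRate]
      ring
    linarith
  · simp only [hWeq]
    have h1 := (abs_le.mp (hcorr 0 le_rfl)).2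
    have h2 := radialEnergy_le (norm_nonneg _) h0 hρ1
    have h3 := radialEnergy_nonneg (a := r / 2) (by linarith) (by linarith)
    linarith

/-! ### Size of the incoherent fixed point -/

theorem norm_alphaI_le {σ δ β : ℝ} (hδ : 0 < δ) (hδ' : δ < Real.pi / 4) (hσ : 0 < σ)
    (hβ : 1 < β) : ‖alphaI σ δ β‖ ≤ σ / (β - 1) := by
  have hcos : 0 < Real.cos (2 * δ) :=
    Real.cos_pos_of_mem_Ioo ⟨by linarith [Real.pi_pos], by linarith⟩
  rw [alphaI, norm_mul, norm_exp_ofReal_mul_I, mul_one, norm_real, Real.norm_eq_abs,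
    incoherentRadius]
  have ha : 0 < β - 1 := sub_pos.mpr hβ
  set a := β - 1
  set b := 1 + 2 * β * Real.cos (2 * δ) with hb
  have hbpos : 0 < b := by positivity
  have h1 : Real.sqrt (a ^ 2 - σ ^ 2 * b) ≤ a := by
    rw [Real.sqrt_le_left ha.le]
    nlinarith [mul_pos (pow_pos hσ 2) hbpos]
  have h2 : a - σ ^ 2 * b / a ≤ Real.sqrt (a ^ 2 - σ ^ 2 * b) := by
    -- The first case includes a negative radicand, for which `Real.sqrt` is 0.
    rcases le_total (a - σ ^ 2 * b / a) 0 with h | h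
    · exact h.trans (Real.sqrt_nonneg _)
    · refine Real.le_sqrt_of_sq_le ?_
      have h3 : σ ^ 2 * b = a * (σ ^ 2 * b / a) := by field_simp
      have h4 : 0 ≤ σ ^ 2 * b / a := by positivity
      nlinarith [mul_nonneg h h4]
  rw [abs_of_nonneg (div_nonneg (by linarith) (by positivity)), div_le_div_iff₀ (by positivity) ha]
  have h3 : σ ^ 2 * b / a * a = σ ^ 2 * b := by field_simp
  nlinarith

/-! ### Neighbourhoods of the splay states -/

theorem continuous_coe_toCircle : Continuous fun a : Real.Angle => (a.toCircle : ℂ) := by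
  simp only [Real.Angle.coe_toCircle]
  have h1 := continuous_ofReal.comp Real.Angle.continuous_cos
  have h2 := continuous_ofReal.comp Real.Angle.continuous_sin
  exact h1.add (h2.mul continuous_const)

/-- The configurations whose points on the circle are `η`-close to those of a splay state. -/
def splayNhd (N : ℕ) (η : ℝ) : Set (Fin N → Real.Angle) :=
  ⋃ θ' ∈ splayStates N, ⋂ j, {θ | ‖((θ j).toCircle : ℂ) - ((θ' j).toCircle : ℂ)‖ < η}

theorem isOpen_splayNhd (N : ℕ) (η : ℝ) : IsOpen (splayNhd N η) := by
  refine isOpen_biUnion fun θ' _ => isOpen_iInter_of_finite fun j => ?_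
  exact isOpen_lt ((continuous_coe_toCircle.comp (continuous_apply j)).sub
    continuous_const).norm continuous_const

theorem splayStates_subset_splayNhd (N : ℕ) {η : ℝ} (hη : 0 < η) :
    splayStates N ⊆ splayNhd N η := fun θ hθ =>
  mem_biUnion hθ (mem_iInter.mpr fun j => by simpa using hη)

theorem exists_norm_phasors_sub_le {N : ℕ} {η : ℝ} {θ : Fin N → Real.Angle}
    (hθ : θ ∈ splayNhd N η) (ψ : ℝ) :
    ∃ (c : ℂ) (s : Equiv.Perm (Fin N)), ‖c‖ = 1 ∧
      ∀ j, ‖phasors ψ θ j - c * exp (2 * Real.pi * I / N) ^ (s j : ℕ)‖ ≤ η := by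
  obtain ⟨θ', ⟨φ, s, hs⟩, hθ'⟩ := mem_iUnion₂.mp hθ
  refine ⟨exp (ψ * I) * (φ.toCircle : ℂ), s, ?_, fun j => ?_⟩
  · rw [norm_mul, norm_exp_ofReal_mul_I, Circle.norm_coe, mul_one]
  · have h1 : ((θ' j).toCircle : ℂ) = φ.toCircle * exp (2 * Real.pi * I / N) ^ (s j : ℕ) := by
      rw [hs j, Real.Angle.toCircle_add, Circle.coe_mul, mul_comm, Real.Angle.toCircle_coe,
        Circle.coe_exp, ← exp_nat_mul]
      congr 2
      push_cast
      ring
    rw [mul_assoc, ← h1, phasors, ← mul_sub, norm_mul, norm_exp_ofReal_mul_I, one_mul]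
    exact (mem_iInter.mp hθ' j).le

/-- For large `N` the order parameter of near-splay configurations is uniformly close to `α` on the
whole disc, and `C^k`-close on smaller discs. -/
theorem exists_splayNhd_orderParam_sub (k : ℕ) {δ₀ ε : ℝ} (hδ₀ : 0 < δ₀) (hε : 0 < ε) :
    ∃ N₀ : ℕ, ∀ N : ℕ, N₀ < N → ∃ η > 0, ∀ θ ∈ splayNhd N η, ∀ ψ : ℝ,
      (∀ α : ℂ, ‖α‖ < 1 → ‖orderParam α ψ θ - α‖ ≤ 3 / N) ∧
      CkNormLE k (1 - δ₀) ε (fun α => orderParam α ψ θ - α) := by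
  -- The maximum with 0 matters because δ₀ may be large.
  set r : ℝ := max (1 - δ₀ / 2) 0 with hr
  have hr0 : 0 ≤ r := le_max_right _ _
  have hr1 : r < 1 := max_lt (by linarith) one_pos
  have hrr : 1 - δ₀ < r := (by linarith : 1 - δ₀ < 1 - δ₀ / 2).trans_le (le_max_left _ _)
  obtain ⟨C, hC, hCk⟩ := exists_ckNormLE_const k hrr
  have hlim : Filter.Tendsto (fun n : ℕ => r ^ (n - 1) / (1 - r ^ n)) Filter.atTop (nhds 0) := by
    have h1 := tendsto_pow_atTop_nhds_zero_of_lt_one hr0 hr1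
    have h2 := (h1.comp (Filter.tendsto_sub_atTop_nat 1)).div (h1.const_sub 1) (by norm_num)
    rw [sub_zero, zero_div] at h2
    exact h2
  obtain ⟨N₀, hN₀⟩ := Filter.eventually_atTop.mp
    (hlim.eventually_le_const (by positivity : (0 : ℝ) < ε / (2 * C)))
  refine ⟨N₀, fun N hN => ?_⟩
  have hN0 : N ≠ 0 := by omega
  obtain ⟨η, hη, hηv⟩ := exists_radius_kernelMean_le hN0 (isPrimitiveRoot_exp N hN0) hr0 hr1
    (by positivity : (0 : ℝ) < ε / (2 * C))
  refine ⟨η, hη, fun θ hθ ψ => ?_⟩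
  obtain ⟨c, s, hc, hcs⟩ := exists_norm_phasors_sub_le hθ ψ
  obtain ⟨h1, h2⟩ := hηv _ c s (norm_phasors ψ θ) hc hcs
  constructor
  · intro α hα
    rw [norm_orderParam_sub_self hN0 hα]
    exact h1 _ (by rwa [norm_conj])
  · have hM : ∀ w ∈ Metric.ball (0 : ℂ) r, ‖kernelMean (phasors ψ θ) w‖ ≤ ε / C := by
      intro w hw
      refine (h2 w (mem_ball_zero_iff.mp hw).le).trans ?_
      have h3 : ε / C = ε / (2 * C) + ε / (2 * C) := by field_simp; norm_num
      linarith [hN₀ N hN.le]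
    have h3 := hCk _ (ε / C) (by positivity)
      ((differentiableOn_kernelMean (norm_phasors ψ θ)).mono (Metric.ball_subset_ball hr1.le)) hM
    rw [mul_div_cancel₀ _ hC.ne'] at h3
    refine h3.congr fun α hα => ?_
    exact orderParam_sub_self hN0 ((mem_ball_zero_iff.mp hα).trans (hrr.trans hr1)) ψ θ

end StarNetwork

end

/-! ### Choice of constants and conclusion -/

theorem mainTheorem7 (k : ℕ) (δ₀ δ σ ε : ℝ) (hδ₀ : 0 < δ₀)
    (hδ : 0 < δ) (hδ' : δ < Real.pi / 4) (hσ : 0 < σ) (hσ' : σ < 1) (hε : 0 < ε) :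
    ∃ (N₀ : ℕ) (β₀ : ℝ), 0 < β₀ ∧ ∀ N : ℕ, N₀ < N →
      ∃ U : Set (Fin N → Real.Angle), IsOpen U ∧ StarNetwork.splayStates N ⊆ U ∧
        (∀ θ ∈ U, ∀ ψ : ℝ, StarNetwork.CkNormLE k (1 - δ₀) ε
          (fun α => StarNetwork.orderParam α ψ θ - α)) ∧
        ∀ β : ℝ, β₀ < β → ∀ z₀ : ℂ, ‖z₀‖ < 1 - δ₀ →
          ∃ T₀ : ℝ, 0 < T₀ ∧
            ∀ θ ∈ U, ∀ (α : ℝ → ℂ) (ψ : ℝ → ℝ),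
              StarNetwork.IsSolution σ δ β θ α ψ →
              StarNetwork.orderParam (α 0) (ψ 0) θ = z₀ →
              ∀ τ : ℝ, T₀ < τ →
                ‖StarNetwork.orderParam (α (τ / β)) (ψ (τ / β)) θ
                  - StarNetwork.alphaI σ δ β‖ ≤ ε := by
  set K := StarNetwork.correctorConst σ with hKdef
  have hK : 0 < K := StarNetwork.correctorConst_pos hσ'
  set r : ℝ := min (ε / 4) (1 / 2) with hr
  have hr0 : 0 < r := lt_min (by linarith) (by norm_num)
  have hr1 : r < 1 := (min_le_right _ _).trans_lt (by norm_num)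
  have hrε : r ≤ ε / 4 := min_le_left _ _
  set m := StarNetwork.decayRate σ δ r with hm
  have hm0 : 0 < m := StarNetwork.decayRate_pos hδ hδ' hσ hσ' hr0
  set gap := StarNetwork.radialEnergy r - StarNetwork.radialEnergy (r / 2) with hgap
  have hgap0 : 0 < gap := sub_pos.mpr (StarNetwork.radialEnergy_lt (by linarith) (by linarith) hr1)
  obtain ⟨N₁, hN₁⟩ := StarNetwork.exists_splayNhd_orderParam_sub k hδ₀ hε
  -- The bounds on 3/N serve, in turn, the final estimate, the confinement of α(0) to radius 1 -
  -- δ₀/2, and half of the drift error.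
  obtain ⟨N₂, hN₂⟩ := Filter.eventually_atTop.mp
    ((tendsto_const_div_atTop_nhds_zero_nat (3 : ℝ)).eventually_le_const
      (lt_min (by linarith) (lt_min (by linarith) (by positivity)) :
        (0 : ℝ) < min (ε / 4) (min (δ₀ / 2) (m / (2 * K)))))
  -- The summands 2 + 4/ε make |α^I| ≤ ε/4; the other two bound the corrector by the energy gap and
  -- the 1/β drift error by m/2.
  refine ⟨max N₁ N₂, 2 + 4 / ε + 2 * K / gap + 2 * K / m, by positivity, fun N hN => ?_⟩
  obtain ⟨η, hη, hηU⟩ := hN₁ N ((le_max_left _ _).trans_lt hN)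
  have h3N := hN₂ N ((le_max_right _ _).trans hN.le)
  have h3Nε : 3 / (N : ℝ) ≤ ε / 4 := h3N.trans (min_le_left _ _)
  have h3Nδ : 3 / (N : ℝ) ≤ δ₀ / 2 := h3N.trans ((min_le_right _ _).trans (min_le_left _ _))
  have h3Nm : 3 / (N : ℝ) ≤ m / (2 * K) := h3N.trans ((min_le_right _ _).trans (min_le_right _ _))
  refine ⟨StarNetwork.splayNhd N η, StarNetwork.isOpen_splayNhd N η,
    StarNetwork.splayStates_subset_splayNhd N hη,
    fun θ hθ ψ => (hηU θ hθ ψ).2, fun β hβ z₀ hz₀ => ?_⟩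
  have hp1 : 0 < 4 / ε := by positivity
  have hp2 : 0 < 2 * K / gap := by positivity
  have hp3 : 0 < 2 * K / m := by positivity
  have hβ0 : 0 < β := by linarith
  -- The existence of z₀ in the disc is what bounds δ₀.
  have hδ₀1 : δ₀ < 1 := by linarith [norm_nonneg z₀]
  have hβgap : 2 * K / β ≤ gap := by
    rw [div_le_iff₀ hβ0, ← div_le_iff₀' hgap0]
    linarith
  have hβm : K * (1 / β + 3 / N) ≤ m := by
    have h1 : K * (1 / β) ≤ m / 2 := by
      rw [mul_one_div, div_le_iff₀ hβ0]
      have : 2 * K ≤ m * β := by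
        rw [← div_le_iff₀' hm0]
        linarith
      linarith
    have h2 : K * (3 / N) ≤ m / 2 := by
      refine (mul_le_mul_of_nonneg_left h3Nm hK.le).trans_eq ?_
      field_simp
    linarith
  obtain ⟨T, hT, hTα⟩ := StarNetwork.exists_time_norm_le hδ hδ' hσ hσ' hr0 hr1
    (by linarith : 0 ≤ 1 - δ₀ / 2) (by linarith) hβ0 hβgap hβm
  refine ⟨β * T, by positivity, fun θ hθ α ψ hsol hz τ hτ => ?_⟩
  have hclose : ∀ t, 0 ≤ t → ‖StarNetwork.orderParam (α t) (ψ t) θ - α t‖ ≤ 3 / N := fun t ht =>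
    (hηU θ hθ (ψ t)).1 (α t) (hsol t ht).1
  have hα0 : ‖α 0‖ ≤ 1 - δ₀ / 2 := by
    have h1 := hclose 0 le_rfl
    rw [hz] at h1
    have h2 := norm_le_norm_add_norm_sub z₀ (α 0)
    linarith
  have hτT : T ≤ τ / β := by
    rw [le_div_iff₀ hβ0]
    linarith
  have h1 := hTα N θ α ψ hsol hclose hα0 (τ / β) hτT
  have h2 := hclose (τ / β) (hT.le.trans hτT)
  have h3 : ‖StarNetwork.alphaI σ δ β‖ ≤ ε / 4 := by
    refine (StarNetwork.norm_alphaI_le hδ hδ' hσ (by linarith)).trans ?_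
    rw [div_le_iff₀ (by linarith)]
    have h4 : ε / 4 * (4 / ε) = 1 := by field_simp
    have h5 : ε / 4 * (4 / ε) ≤ ε / 4 * (β - 1) :=
      mul_le_mul_of_nonneg_left (by linarith) (by linarith)
    linarith
  have h4 := norm_sub_le (StarNetwork.orderParam (α (τ / β)) (ψ (τ / β)) θ)
    (StarNetwork.alphaI σ δ β)
  have h5 := norm_le_norm_sub_add (StarNetwork.orderParam (α (τ / β)) (ψ (τ / β)) θ)
    (α (τ / β))
  linarith
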